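/- Theorem. Let $\mathbb{S}=\bigcup_{n\ge0}\{0,1\}^n$ be the set of situations (finite binary strings, with empty string $\square$) and $\Omega=\{0,1\}^{\mathbb{N}}$ the set of paths; $\omega^n$ denotes the string of the first $n$ entries of $\omega\in\Omega$, and for $S\subseteq\mathbb{S}$, $[\![S]\!]$ is the set of all paths $\omega$ with $\omega^n\in S$ for some $n\ge0$. A forecasting system is a map $\varphi$ that assigns to every $s\in\mathbb{S}$ a non-empty closed interval $\varphi(s)=[\underline\varphi(s),\overline\varphi(s)]\subseteq[0,1]$. It is non-degenerate if $\underline\varphi(s)<1$ and $\overline\varphi(s)>0$ for all $s\in\mathbb{S}$. A map $r\colon\mathbb{S}\to\mathbb{R}$ is lower semicomputable if there is a recursive map $q\colon\mathbb{S}\times\mathbb{N}_0\to\mathbb{Q}$ with $q(s,n)\le q(s,n+1)$ and $\lim_{m\to\infty}q(s,m)=r(s)$ for all $s$ and $n$; it is computable if both $r$ and $-r$ are lower semicomputable. The forecasting system $\varphi$ is computable if both $\underline\varphi$ and $\overline\varphi$ are computable. A supermartingale for $\varphi$ is a map $M\colon\mathbb{S}\to\mathbb{R}$ such that $\max_{p\in\varphi(s)}[pM(s1)+(1-p)M(s0)]\le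 M(s)$ for all $s\in\mathbb{S}$; it is a test supermartingale if moreover $M\ge0$ and $M(\square)=1$. The upper probability of $G\subseteq\Omega$ is $$\overline{P}^{\varphi}(G)=\inf\Big\{M(\square):M\text{ is a supermartingale for }\varphi\text{ with }\liminf_{n\to\infty}M(\omega^n)\ge\mathbb{I}_G(\omega)\text{ for all }\omega\in\Omega\Big\},$$ where $\mathbb{I}_G$ is the indicator of $G$. A path $\omega$ is Martin-Löf random for $\varphi$ if $\sup_{n}T(\omega^n)<\infty$ for every lower semicomputable test supermartingale $T$ for $\varphi$. A Martin-Löf test for $\varphi$ is a sequence $(G_n)_{n\in\mathbb{N}_0}$ of subsets of $\Omega$ for which there is a recursively enumerable set $A\subseteq\mathbb{N}_0\times\mathbb{S}$ such that $G_n=[\![\{s:(n,s)\in A\}]\!]$ and $\overline{P}^{\varphi}(G_n)\le2^{-n}$ for all $n\in\mathbb{N}_0$. A path $\omega$ is Martin-Löf test random for $\varphi$ if $\omega\notin\bigcap_{n\in\mathbb{N}_0}G_n$ for every Martin-Löf test $(G_n)$ for $\varphi$. Let $\varphi$ be a forecasting system and $\omega\in\Omega$ a path. 1. If $\omega$ is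 Martin-Löf test random for $\varphi$, then $\omega$ is Martin-Löf random for $\varphi$. 2. If $\varphi$ is non-degenerate and computable, then $\omega$ is Martin-Löf random for $\varphi$ if and only if $\omega$ is Martin-Löf test random for $\varphi$. -/

import Mathlib

namespace GameRandomness

/-- A situation: a finite string `(x₁, …, xₙ)` of outcomes in `{0, 1}` (`true` is the outcome `1`,
`false` the outcome `0`); the initial situation is `[]` and `s x` is `s ++ [x]`. -/
abbrev Situation := List Bool

/-- A path: an infinite sequence of outcomes. -/
abbrev Path := ℕ → Bool

/-- The situation consisting of the first `n` outcomes of the path `ω`. -/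
def Path.upTo (ω : Path) (n : ℕ) : Situation := (List.range n).map ω

/-- The cylinder set of all paths that go through the situation `s`. -/
def cylinder (s : Situation) : Set Path := {ω | ∃ n, Path.upTo ω n = s}

/-- The set of all paths that go through some situation in `S`. -/
def cylinderSet (S : Set Situation) : Set Path := ⋃ s ∈ S, cylinder s

/-! ### Interval forecasts and forecasting systems -/

/-- An interval forecast: a non-empty closed subinterval `[min I, max I]` of `[0, 1]`. -/
abbrev IntervalForecast := NonemptyInterval unitInterval

/-- `p f(1) + (1 - p) f(0)`. -/
def expectation (p : ℝ) (f : Bool → ℝ) : ℝ := p * f true + (1 - p) * f false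

/-- The local upper expectation: the maximum over `p ∈ I` of `p f(1) + (1 - p) f(0)`. -/
noncomputable def localUpper (I : IntervalForecast) (f : Bool → ℝ) : ℝ :=
  sSup ((fun p => expectation p f) '' Set.Icc (I.fst : ℝ) (I.snd : ℝ))

/-- The supremum in `localUpper` is a maximum. -/
theorem isGreatest_localUpper (I : IntervalForecast) (f : Bool → ℝ) :
    IsGreatest ((fun p => expectation p f) '' Set.Icc (I.fst : ℝ) (I.snd : ℝ))
      (localUpper I f) := by
  have hI : (I.fst : ℝ) ≤ (I.snd : ℝ) := I.fst_le_snd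
  refine IsCompact.isGreatest_sSup (isCompact_Icc.image ?_) ?_
  · unfold expectation
    fun_prop
  · exact (Set.nonempty_Icc.mpr hI).image _

/-- A forecasting system attaches an interval forecast to every situation. -/
abbrev ForecastingSystem := Situation → IntervalForecast

/-- The lower forecast `s ↦ min φ(s)`. -/
def lowerForecast (φ : ForecastingSystem) (s : Situation) : ℝ := ((φ s).fst : ℝ)

/-- The upper forecast `s ↦ max φ(s)`. -/
def upperForecast (φ : ForecastingSystem) (s : Situation) : ℝ := ((φ s).snd : ℝ)

/-- Non-degeneracy: `φ` never takes the values `{0}` and `{1}`. -/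
def NonDegenerate (φ : ForecastingSystem) : Prop :=
  ∀ s, lowerForecast φ s < 1 ∧ 0 < upperForecast φ s

/-! ### Supermartingales and global upper expectations -/

/-- A supermartingale for `φ`: a real process `M` whose differences `M(s ·) - M(s)` have
non-positive local upper expectation. -/
def IsSupermartingale (φ : ForecastingSystem) (M : Situation → ℝ) : Prop :=
  ∀ s, localUpper (φ s) (fun x => M (s ++ [x]) - M s) ≤ 0

/-- A test supermartingale: a non-negative supermartingale with initial value `1`. -/
def IsTestSupermartingale (φ : ForecastingSystem) (T : Situation → ℝ) : Prop :=
  IsSupermartingale φ T ∧ (∀ s, 0 ≤ T s) ∧ T [] = 1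

/-- The global conditional upper expectation of a gamble (a bounded real map) `g` on the set of
paths: the infimum of `M(s)` over all supermartingales `M` with `lim inf M ≥ g` on all paths through
`s`. The limit inferior is taken in the extended reals. -/
noncomputable def upperExpectation (φ : ForecastingSystem) (g : Path → ℝ) (s : Situation) : ℝ :=
  sInf {c : ℝ | ∃ M : Situation → ℝ, IsSupermartingale φ M ∧
    (∀ ω ∈ cylinder s,
      ((g ω : ℝ) : EReal) ≤
        Filter.liminf (fun n => ((M (Path.upTo ω n) : ℝ) : EReal)) Filter.atTop) ∧
    M s = c}

/-- The (unconditional) upper probability of a global event. -/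
noncomputable def upperProbability (φ : ForecastingSystem) (G : Set Path) : ℝ :=
  upperExpectation φ (G.indicator fun _ => 1) []

/-! ### Computability -/

/-- A recursive rational map. A rational number is coded by naturals `a, b, c` as
`(a - b) / (c + 1)`. -/
def RecursiveRat {D : Type*} [Primcodable D] (q : D → ℚ) : Prop :=
  ∃ a b c : D → ℕ, Computable a ∧ Computable b ∧ Computable c ∧
    ∀ d, q d = ((a d : ℚ) - (b d : ℚ)) / ((c d : ℚ) + 1)

/-- Lower semicomputable real maps: limits of recursive non-decreasing rational approximations. -/
def LowerSemicomputable {D : Type*} [Primcodable D] (r : D → ℝ) : Prop :=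
  ∃ q : D × ℕ → ℚ, RecursiveRat q ∧ (∀ d n, q (d, n) ≤ q (d, n + 1)) ∧
    ∀ d, Filter.Tendsto (fun n => (q (d, n) : ℝ)) Filter.atTop (nhds (r d))

/-- Upper semicomputable real maps. -/
def UpperSemicomputable {D : Type*} [Primcodable D] (r : D → ℝ) : Prop :=
  LowerSemicomputable fun d => -r d

/-- Computable real maps. -/
def ComputableReal {D : Type*} [Primcodable D] (r : D → ℝ) : Prop :=
  LowerSemicomputable r ∧ UpperSemicomputable r

/-- A computable forecasting system: both its lower and its upper forecasts are computable. -/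
def ComputableForecast (φ : ForecastingSystem) : Prop :=
  ComputableReal (lowerForecast φ) ∧ ComputableReal (upperForecast φ)

/-! ### Randomness -/

/-- Martin-Löf randomness: every lower semicomputable test supermartingale stays bounded above
along `ω`. -/
def MartinLofRandom (φ : ForecastingSystem) (ω : Path) : Prop :=
  ∀ T : Situation → ℝ, IsTestSupermartingale φ T → LowerSemicomputable T →
    ∃ B : ℝ, ∀ n, T (Path.upTo ω n) ≤ B

/-- A Martin-Löf test for `φ`: a sequence of global events generated by a recursively enumerable
subset `A` of `ℕ × {situations}`, the `n`-th of which has upper probability at most `2⁻ⁿ`. -/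
def IsMartinLofTest (φ : ForecastingSystem) (G : ℕ → Set Path) : Prop :=
  ∃ A : Set (ℕ × Situation), REPred (fun a => a ∈ A) ∧
    ∀ n, G n = cylinderSet {s | (n, s) ∈ A} ∧
      upperProbability φ (cylinderSet {s | (n, s) ∈ A}) ≤ (1 / 2 : ℝ) ^ n

/-- Martin-Löf test randomness: `ω` avoids the intersection of every Martin-Löf test. -/
def MartinLofTestRandom (φ : ForecastingSystem) (ω : Path) : Prop :=
  ∀ G : ℕ → Set Path, IsMartinLofTest φ G → ω ∉ ⋂ m, G m

end GameRandomness

namespace GameRandomness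

open Filter Topology

/-! ### Computability -/

/-! Both implications translate between a test supermartingale that is unbounded along `ω` and a
sequence of events of small upper probability that all contain `ω`.

From test randomness to randomness: if a lower semicomputable test supermartingale `T` is unbounded
along `ω`, then `ω` lies in every event "`T` exceeds `2 ^ n`". These events are uniformly
recursively enumerable, and Ville's inequality (`upperProbability_exceeds_le`) bounds their upper
probabilities by `2⁻ⁿ`.

Conversely, given a test, let `hedge` at `s` be the limit of computable backward recursions for the
conditional upper probability of the `n`-th event. It equals `1` once the event is certain to have
been entered, is itself a supermartingale (`isSupermartingale_hedge`), and lies below every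
superhedge (`hedge_le`), so its initial value is at most `2⁻ⁿ`. Computability of the forecasts makes
it lower semicomputable. Summing over `n ≥ 1` gives a process with initial value at most `1`;
non-degeneracy keeps the sum finite in every situation (`NonDegenerate.summable`). Along a path in
all the events each summand eventually equals `1`, so the sum is unbounded there. -/

theorem rePred_of_exists {D : Type*} [Primcodable D] {d : D × ℕ → Bool} (hd : Computable d) :
    REPred fun x => ∃ k, d (x, k) = true := by
  have h : Partrec₂ fun (x : D) (k : ℕ) => Part.some (d (x, k)) := hd
  refine (Partrec.rfind h).dom_re.of_eq fun x => ?_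
  refine (Nat.rfind_dom (p := fun k => Part.some (d (x, k)))).trans (exists_congr fun k => ?_)
  exact ⟨fun h => (Part.mem_some_iff.1 h.1).symm,
    fun h => ⟨Part.mem_some_iff.2 h.symm, fun _ => trivial⟩⟩

/-- A code for the semi-decision procedure, run with the bounded evaluator `evaln`, halts within
some bound exactly when `p` holds. -/
theorem exists_decidable_stage {D : Type*} [Primcodable D] {p : D → Prop} (hp : REPred p) :
    ∃ d : D × ℕ → Bool, Computable d ∧ ∀ x, p x ↔ ∃ k, d (x, k) = true := by
  obtain ⟨c, hc⟩ := Nat.Partrec.Code.exists_code.1 hp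
  refine ⟨fun x => (Nat.Partrec.Code.evaln x.2 c (Encodable.encode x.1)).isSome, ?_, fun x => ?_⟩
  · exact Primrec.option_isSome.to_comp.comp (Nat.Partrec.Code.primrec_evaln.to_comp.comp
      ((Computable.snd.pair (Computable.const c)).pair (Computable.encode.comp Computable.fst)))
  · have h1 : p x ↔ (Nat.Partrec.Code.eval c (Encodable.encode x)).Dom := by
      rw [hc]
      simp [Part.assert]
    rw [h1, Part.dom_iff_mem]
    simp only [Nat.Partrec.Code.evaln_complete, Option.isSome_iff_exists, Option.mem_def]
    exact exists_comm

theorem computable_exists_lt {D : Type*} [Primcodable D] {d : D × ℕ → Bool} (hd : Computable d) :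
    ∃ e : D × ℕ → Bool, Computable e ∧ ∀ x n, e (x, n) = true ↔ ∃ k < n, d (x, k) = true := by
  refine ⟨fun x => Nat.rec (motive := fun _ => Bool) false (fun k b => b || d (x.1, k)) x.2,
    ?_, fun x n => ?_⟩
  · refine Computable.nat_rec (f := fun x : D × ℕ => x.2) (g := fun _ => false)
      (h := fun x y => y.2 || d (x.1, y.1)) Computable.snd (Computable.const false) ?_
    exact (Primrec.or.to_comp.comp (Computable.snd.comp Computable.snd)
      (hd.comp ((Computable.fst.comp Computable.fst).pair
        (Computable.fst.comp Computable.snd)))).to₂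
  · induction n with
    | zero => simp
    | succ n ih =>
      simp only [Bool.or_eq_true] at ih ⊢
      rw [ih]
      constructor
      · rintro (⟨k, hk, h⟩ | h)
        · exact ⟨k, by omega, h⟩
        · exact ⟨n, by omega, h⟩
      · rintro ⟨k, hk, h⟩
        rcases Nat.lt_succ_iff_lt_or_eq.1 hk with hk | rfl
        · exact Or.inl ⟨k, hk, h⟩
        · exact Or.inr h

/-- A function defined by binary tree recursion on a fuel parameter is computable. -/
theorem computable_treeRec {P D : Type*} [Primcodable P] [Primcodable D]
    {b : P × D → ℕ} {h : (P × D) × ℕ × ℕ → ℕ} {l r : D → D} (hb : Computable b)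
    (hh : Computable h) (hl : Computable l) (hr : Computable r) {g : P → ℕ → D → ℕ}
    (g_zero : ∀ p x, g p 0 x = b (p, x))
    (g_succ : ∀ p k x, g p (k + 1) x = h ((p, x), g p k (l x), g p k (r x))) :
    Computable fun x : (P × D) × ℕ => g x.1.1 x.2 x.1.2 := by
  let F : Nat.Partrec.Code → (P × D) × ℕ →. ℕ := fun c y =>
    Nat.casesOn y.2 (Part.some (b y.1)) fun k =>
      (Nat.Partrec.Code.eval c (Encodable.encode ((y.1.1, l y.1.2), k))).bind fun u =>
        (Nat.Partrec.Code.eval c (Encodable.encode ((y.1.1, r y.1.2), k))).bind fun v =>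
          Part.some (h (y.1, u, v))
  have hF : Partrec fun a : Nat.Partrec.Code × ((P × D) × ℕ) => F a.1 a.2 := by
    refine Partrec.nat_casesOn_right (Computable.snd.comp Computable.snd)
      (hb.comp (Computable.fst.comp Computable.snd)) ?_
    have hc : Computable fun z : (Nat.Partrec.Code × ((P × D) × ℕ)) × ℕ => z.1.1 :=
      Computable.fst.comp Computable.fst
    have hx : Computable fun z : (Nat.Partrec.Code × ((P × D) × ℕ)) × ℕ => z.1.2.1 :=
      Computable.fst.comp (Computable.snd.comp Computable.fst)
    have hcall : ∀ {m : D → D}, Computable m →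
        Partrec fun z : (Nat.Partrec.Code × ((P × D) × ℕ)) × ℕ =>
          Nat.Partrec.Code.eval z.1.1 (Encodable.encode ((z.1.2.1.1, m z.1.2.1.2), z.2)) :=
      fun hm => Nat.Partrec.Code.eval_part.comp hc
        (Computable.encode.comp (((Computable.fst.comp hx).pair
          (hm.comp (Computable.snd.comp hx))).pair Computable.snd))
    have hval : Computable fun w : (((Nat.Partrec.Code × ((P × D) × ℕ)) × ℕ) × ℕ) × ℕ =>
        h (w.1.1.1.2.1, w.1.2, w.2) :=
      hh.comp ((hx.comp (Computable.fst.comp Computable.fst)).pair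
        ((Computable.snd.comp Computable.fst).pair Computable.snd))
    exact (hcall hl).bind (((hcall hr).comp Computable.fst).bind hval.partrec.to₂).to₂
  have hG : Partrec₂ fun (c : Nat.Partrec.Code) (n : ℕ) =>
      (Part.ofOption (Encodable.decode (α := (P × D) × ℕ) n)).bind fun y => F c y :=
    (Computable.decode.comp Computable.snd).ofOption.bind
      (hF.comp ((Computable.fst.comp Computable.fst).pair Computable.snd)).to₂
  -- Both recursive calls change the argument `x`, so the recursion is realised by Kleene's
  -- recursion theorem: `c` is a code that calls itself where `F` calls its first argument.
  -- Induction on the fuel then shows that `c` halts with value `g`.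
  obtain ⟨c, hc⟩ := Nat.Partrec.Code.fixed_point₂ hG
  have key : ∀ k p x, Nat.Partrec.Code.eval c (Encodable.encode ((p, x), k)) =
      Part.some (g p k x) := by
    intro k
    induction k with
    | zero => intro p x; rw [hc]; simp [F, g_zero]
    | succ k ih => intro p x; rw [hc]; simp [F, g_succ, ih, -Encodable.encode_prod_val]
  refine Partrec.of_eq (f := fun y : (P × D) × ℕ => Nat.Partrec.Code.eval c (Encodable.encode y))
    (Nat.Partrec.Code.eval_part.comp (Computable.const c) Computable.encode) ?_
  rintro ⟨⟨p, x⟩, k⟩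
  exact key k p x

theorem computable_two_pow {D : Type*} [Primcodable D] {f : D → ℕ} (hf : Computable f) :
    Computable fun x => 2 ^ f x := by
  have h : Computable fun x => Nat.rec (motive := fun _ => ℕ) 1 (fun _ b => 2 * b) (f x) :=
    Computable.nat_rec hf (Computable.const 1)
      (Primrec.nat_mul.to_comp.comp (Computable.const 2)
        (Computable.snd.comp Computable.snd)).to₂
  refine h.of_eq fun x => ?_
  induction f x with
  | zero => rfl
  | succ n ih => simp only [ih]; rw [pow_succ, mul_comm]

theorem computable_sum_range {D : Type*} [Primcodable D] {f : D × ℕ → ℕ} {g : D → ℕ}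
    (hf : Computable f) (hg : Computable g) :
    Computable fun x => ∑ i ∈ Finset.range (g x), f (x, i) := by
  have h : Computable fun x =>
      Nat.rec (motive := fun _ => ℕ) 0 (fun i b => b + f (x, i)) (g x) :=
    Computable.nat_rec hg (Computable.const 0)
      (Primrec.nat_add.to_comp.comp (Computable.snd.comp Computable.snd)
        (hf.comp (Computable.fst.pair (Computable.fst.comp Computable.snd)))).to₂
  refine h.of_eq fun x => ?_
  induction g x with
  | zero => rfl
  | succ n ih => simp only [ih]; rw [Finset.sum_range_succ]

/-! ### Dyadic approximations of lower semicomputable maps -/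

theorem lowerSemicomputable_of_dyadic {D : Type*} [Primcodable D] {r : D → ℝ} {N : D × ℕ → ℕ}
    (hN : Computable N) (hmono : ∀ x m, 2 * N (x, m) ≤ N (x, m + 1))
    (hlim : ∀ x, Tendsto (fun m => (N (x, m) : ℝ) / 2 ^ m) atTop (𝓝 (r x))) :
    LowerSemicomputable r := by
  refine ⟨fun x => (N x : ℚ) / 2 ^ x.2, ⟨N, fun _ => 0, fun x => 2 ^ x.2 - 1, hN,
    Computable.const 0, ?_, ?_⟩, ?_, ?_⟩
  · exact Primrec.nat_sub.to_comp.comp (computable_two_pow Computable.snd) (Computable.const 1)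
  · intro x
    have : (1 : ℕ) ≤ 2 ^ x.2 := Nat.one_le_two_pow
    push_cast [Nat.cast_sub this]
    ring
  · intro x m
    have h : (2 * N (x, m) : ℚ) ≤ N (x, m + 1) := by exact_mod_cast hmono x m
    simp only
    rw [div_le_div_iff₀ (by positivity) (by positivity), pow_succ]
    nlinarith [show (0 : ℚ) < 2 ^ m by positivity]
  · intro x
    simpa using hlim x

/-- Take the floor of `2 ^ m * max 0 (e + q)`. Doubling a floor never exceeds the floor of the
double, so the fractions increase; the rounding error is below `2⁻ᵐ`. The shift `e` serves `1 -
lowerForecast`, which is `1` plus a negated forecast. -/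
theorem exists_dyadic_of_lowerSemicomputable {D : Type*} [Primcodable D] {r : D → ℝ} (e : ℕ)
    (hr : LowerSemicomputable r) (hr0 : ∀ x, 0 ≤ e + r x) :
    ∃ N : D × ℕ → ℕ, Computable N ∧ (∀ x m, 2 * N (x, m) ≤ N (x, m + 1)) ∧
      (∀ x m, (N (x, m) : ℝ) / 2 ^ m ≤ e + r x) ∧
      ∀ x, Tendsto (fun m => (N (x, m) : ℝ) / 2 ^ m) atTop (𝓝 (e + r x)) := by
  obtain ⟨q, ⟨a, b, c, ha, hb, hc, hq⟩, hmono, hlim⟩ := hr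
  have hle : ∀ x m, (q (x, m) : ℝ) ≤ r x := fun x m =>
    Monotone.ge_of_tendsto (f := fun n => (q (x, n) : ℝ))
      (monotone_nat_of_le_succ fun n => by exact_mod_cast hmono x n) (hlim x) m
  have hfloor : ∀ y : D × ℕ, 2 ^ y.2 * (e * (c y + 1) + a y - b y) / (c y + 1) =
      ⌊(2 : ℝ) ^ y.2 * max 0 (e + (q y : ℝ))⌋₊ := by
    intro y
    rw [← Nat.floor_div_eq_div (K := ℝ)]
    congr 1
    have hcpos : (0 : ℝ) < (c y : ℝ) + 1 := by positivity
    have hqy : (q y : ℝ) = ((a y : ℝ) - b y) / ((c y : ℝ) + 1) := by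
      rw [hq y]; push_cast; rfl
    -- Truncated subtraction of naturals supplies the `max 0`.
    have hsub : ((e * (c y + 1) + a y - b y : ℕ) : ℝ) =
        max 0 ((e : ℝ) * (c y + 1) + a y - b y) := by
      rcases le_total (b y) (e * (c y + 1) + a y) with h | h
      · rw [max_eq_right]
        · push_cast [Nat.cast_sub h]; ring
        · have : (b y : ℝ) ≤ e * (c y + 1) + a y := by exact_mod_cast h
          linarith
      · rw [max_eq_left, Nat.sub_eq_zero_of_le h, Nat.cast_zero]
        have : (e : ℝ) * (c y + 1) + a y ≤ b y := by exact_mod_cast h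
        linarith
    have hmax : max 0 (e + (q y : ℝ)) =
        max 0 ((e : ℝ) * (c y + 1) + a y - b y) / (c y + 1) := by
      rw [← max_div_div_right hcpos.le, zero_div, hqy]
      congr 1
      field_simp
      ring
    rw [Nat.cast_mul, hsub, hmax]
    push_cast
    ring
  refine ⟨fun y => 2 ^ y.2 * (e * (c y + 1) + a y - b y) / (c y + 1), ?_, ?_, ?_, ?_⟩
  · have hc1 : Computable fun y => c y + 1 := Computable.succ.comp hc
    exact Primrec.nat_div.to_comp.comp (Primrec.nat_mul.to_comp.comp
      (computable_two_pow Computable.snd)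
      (Primrec.nat_sub.to_comp.comp (Primrec.nat_add.to_comp.comp
        (Primrec.nat_mul.to_comp.comp (Computable.const e) hc1) ha) hb)) hc1
  · intro x m
    have hf := hfloor (x, m)
    have hf' := hfloor (x, m + 1)
    dsimp only at hf hf' ⊢
    rw [hf, hf']
    apply Nat.le_floor
    push_cast
    have h1 : (⌊(2 : ℝ) ^ m * max 0 (e + (q (x, m) : ℝ))⌋₊ : ℝ) ≤
        2 ^ m * max 0 (e + (q (x, m) : ℝ)) := Nat.floor_le (by positivity)
    have h2 : max 0 (e + (q (x, m) : ℝ)) ≤ max 0 (e + (q (x, m + 1) : ℝ)) :=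
      max_le_max_left _ (by have : (q (x, m) : ℝ) ≤ q (x, m + 1) := by exact_mod_cast hmono x m
                            linarith)
    have h3 : (0 : ℝ) < 2 ^ m := by positivity
    rw [pow_succ]
    nlinarith
  · intro x m
    have hf := hfloor (x, m)
    dsimp only at hf ⊢
    rw [hf, div_le_iff₀ (by positivity)]
    refine (Nat.floor_le (by positivity)).trans ?_
    rw [mul_comm]
    gcongr
    exact max_le (hr0 x) (by have := hle x m; linarith)
  · intro x
    have hmax : Tendsto (fun m => max 0 ((e : ℝ) + (q (x, m) : ℝ))) atTop (𝓝 (e + r x)) := by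
      have := (tendsto_const_nhds (x := (0 : ℝ)) (f := atTop)).max
        ((tendsto_const_nhds (x := (e : ℝ))).add (hlim x))
      rwa [max_eq_right (hr0 x)] at this
    have hpow : Tendsto (fun m : ℕ => (1 / 2 : ℝ) ^ m) atTop (𝓝 0) :=
      tendsto_pow_atTop_nhds_zero_of_lt_one (by norm_num) (by norm_num)
    have hlow := hmax.sub hpow
    rw [sub_zero] at hlow
    refine tendsto_of_tendsto_of_tendsto_of_le_of_le hlow hmax (fun m => ?_) (fun m => ?_)
    · have hf := hfloor (x, m)
      dsimp only at hf ⊢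
      rw [hf, le_div_iff₀ (by positivity), sub_mul, ← mul_pow]
      have := Nat.lt_floor_add_one ((2 : ℝ) ^ m * max 0 (e + (q (x, m) : ℝ)))
      norm_num
      linarith
    · have hf := hfloor (x, m)
      dsimp only at hf ⊢
      rw [hf, div_le_iff₀ (by positivity), mul_comm]
      exact Nat.floor_le (by positivity)

/-! ### Paths and situations -/

theorem Path.upTo_succ (ω : Path) (n : ℕ) : Path.upTo ω (n + 1) = Path.upTo ω n ++ [ω n] := by
  simp [Path.upTo, List.range_succ]

theorem Path.length_upTo (ω : Path) (n : ℕ) : (Path.upTo ω n).length = n := by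
  simp [Path.upTo]

theorem Path.upTo_prefix_upTo (ω : Path) {m n : ℕ} (h : m ≤ n) :
    Path.upTo ω m <+: Path.upTo ω n := by
  induction n, h using Nat.le_induction with
  | base => exact List.prefix_refl _
  | succ n _ ih => rw [Path.upTo_succ]; exact ih.trans (List.prefix_append _ _)

theorem mem_cylinder_of_prefix {ω : Path} {s t : Situation} (hs : ω ∈ cylinder s)
    (h : t <+: s) : ω ∈ cylinder t := by
  obtain ⟨n, rfl⟩ := hs
  have hle : t.length ≤ n := by simpa [Path.length_upTo] using h.length_le
  exact ⟨t.length, (List.prefix_of_prefix_length_le (Path.upTo_prefix_upTo ω hle) h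
    (by rw [Path.length_upTo])).eq_of_length (Path.length_upTo _ _)⟩

theorem mem_cylinderSet {S : Set Situation} {ω : Path} :
    ω ∈ cylinderSet S ↔ ∃ n, Path.upTo ω n ∈ S := by
  simp only [cylinderSet, Set.mem_iUnion]
  constructor
  · rintro ⟨s, hs, n, rfl⟩
    exact ⟨n, hs⟩
  · rintro ⟨n, hn⟩
    exact ⟨_, hn, n, rfl⟩

/-- Following `next` from `s` onwards gives a path through `s`. -/
theorem exists_path_following (next : Situation → Bool) (s : Situation) :
    ∃ ω : Path, Path.upTo ω s.length = s ∧
      ∀ n, s.length ≤ n → ω n = next (Path.upTo ω n) := by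
  let c : ℕ → Situation := fun k => Nat.rec s (fun _ t => t ++ [next t]) k
  let ω : Path := fun i => if h : i < s.length then s[i] else next (c (i - s.length))
  have h0 : Path.upTo ω s.length = s := by
    refine List.ext_getElem (Path.length_upTo _ _) fun i h1 h2 => ?_
    simp [Path.upTo, ω, h2]
  have hc : ∀ k, Path.upTo ω (s.length + k) = c k := by
    intro k
    induction k with
    | zero => exact h0
    | succ k ih =>
      rw [← add_assoc, Path.upTo_succ, ih]
      simp [ω, c]
  refine ⟨ω, h0, fun n hn => ?_⟩
  obtain ⟨k, rfl⟩ := Nat.exists_eq_add_of_le hn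
  rw [hc]
  simp [ω]

/-! ### Supermartingales -/

theorem isSupermartingale_iff {φ : ForecastingSystem} {M : Situation → ℝ} :
    IsSupermartingale φ M ↔ ∀ s, ∀ p ∈ Set.Icc (lowerForecast φ s) (upperForecast φ s),
      p * M (s ++ [true]) + (1 - p) * M (s ++ [false]) ≤ M s := by
  refine forall_congr' fun s => ?_
  have hg := isGreatest_localUpper (φ s) fun x => M (s ++ [x]) - M s
  rw [isLUB_le_iff hg.isLUB, mem_upperBounds, Set.forall_mem_image]
  refine forall₂_congr fun p _ => ?_
  simp only [expectation]
  constructor <;> intro h <;> linarith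

theorem lowerForecast_nonneg (φ : ForecastingSystem) (s : Situation) : 0 ≤ lowerForecast φ s :=
  (φ s).fst.2.1

theorem upperForecast_le_one (φ : ForecastingSystem) (s : Situation) : upperForecast φ s ≤ 1 :=
  (φ s).snd.2.2

theorem lowerForecast_le_upperForecast (φ : ForecastingSystem) (s : Situation) :
    lowerForecast φ s ≤ upperForecast φ s :=
  (φ s).fst_le_snd

theorem isSupermartingale_const (φ : ForecastingSystem) (c : ℝ) :
    IsSupermartingale φ fun _ => c :=
  isSupermartingale_iff.2 fun s p _ => by linarith

theorem IsSupermartingale.const_mul {φ : ForecastingSystem} {M : Situation → ℝ}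
    (hM : IsSupermartingale φ M) {c : ℝ} (hc : 0 ≤ c) :
    IsSupermartingale φ fun s => c * M s := by
  rw [isSupermartingale_iff] at hM ⊢
  intro s p hp
  have := mul_le_mul_of_nonneg_left (hM s p hp) hc
  linarith

theorem IsSupermartingale.exists_child_le {φ : ForecastingSystem} {M : Situation → ℝ}
    (hM : IsSupermartingale φ M) (s : Situation) : ∃ x, M (s ++ [x]) ≤ M s := by
  by_contra! h
  have h1 := h true
  have h0 := h false
  have hp := isSupermartingale_iff.1 hM s (lowerForecast φ s)
    ⟨le_rfl, lowerForecast_le_upperForecast φ s⟩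
  have hp0 := lowerForecast_nonneg φ s
  have hp1 := (lowerForecast_le_upperForecast φ s).trans (upperForecast_le_one φ s)
  rcases hp0.eq_or_lt with he | hl
  · rw [← he] at hp
    linarith
  · nlinarith

/-- Some child never has a larger value than its parent. Following such children from `s` gives a
path on which `M` stays below `M s`, hence so does its limit inferior. -/
theorem IsSupermartingale.le_of_forall_le_liminf {φ : ForecastingSystem} {M : Situation → ℝ}
    (hM : IsSupermartingale φ M) (s : Situation) {c : ℝ}
    (h : ∀ ω ∈ cylinder s, ((c : ℝ) : EReal) ≤
      liminf (fun n => ((M (Path.upTo ω n) : ℝ) : EReal)) atTop) : c ≤ M s := by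
  choose next hnext using hM.exists_child_le
  obtain ⟨ω, h0, hω⟩ := exists_path_following next s
  have hle : ∀ n, s.length ≤ n → M (Path.upTo ω n) ≤ M s := by
    intro n hn
    induction n, hn using Nat.le_induction with
    | base => rw [h0]
    | succ n hn ih =>
      rw [Path.upTo_succ, hω n hn]
      exact (hnext _).trans ih
  have h1 : liminf (fun n => ((M (Path.upTo ω n) : ℝ) : EReal)) atTop ≤ (M s : EReal) := by
    refine liminf_le_of_frequently_le' (Eventually.frequently ?_)
    filter_upwards [eventually_ge_atTop s.length] with n hn
    exact_mod_cast hle n hn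
  exact_mod_cast (h ω ⟨_, h0⟩).trans h1

/-- `M` is a superhedge for the event `G`: a supermartingale with `lim inf M ≥ 𝕀_G`. -/
def IsSuperhedge (φ : ForecastingSystem) (G : Set Path) (M : Situation → ℝ) : Prop :=
  IsSupermartingale φ M ∧ ∀ ω, ((G.indicator (fun _ => (1 : ℝ)) ω : ℝ) : EReal) ≤
    liminf (fun n => ((M (Path.upTo ω n) : ℝ) : EReal)) atTop

theorem IsSuperhedge.nonneg {φ : ForecastingSystem} {G : Set Path} {M : Situation → ℝ}
    (hM : IsSuperhedge φ G M) (s : Situation) : 0 ≤ M s :=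
  hM.1.le_of_forall_le_liminf s fun ω _ => le_trans
    (by exact_mod_cast Set.indicator_nonneg (fun _ _ => zero_le_one) ω) (hM.2 ω)

theorem IsSuperhedge.one_le {φ : ForecastingSystem} {G : Set Path} {M : Situation → ℝ}
    (hM : IsSuperhedge φ G M) {s : Situation} (hs : cylinder s ⊆ G) : 1 ≤ M s :=
  hM.1.le_of_forall_le_liminf s fun ω hω => by
    have := hM.2 ω
    rwa [Set.indicator_of_mem (hs hω)] at this

theorem upperProbability_eq_sInf (φ : ForecastingSystem) (G : Set Path) :
    upperProbability φ G = sInf {c : ℝ | ∃ M, IsSuperhedge φ G M ∧ M [] = c} := by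
  have hmem : ∀ ω : Path, ω ∈ cylinder [] := fun ω => ⟨0, rfl⟩
  simp only [upperProbability, upperExpectation, IsSuperhedge, hmem, forall_const, and_assoc]

theorem upperProbability_le {φ : ForecastingSystem} {G : Set Path} {M : Situation → ℝ}
    (hM : IsSuperhedge φ G M) : upperProbability φ G ≤ M [] := by
  rw [upperProbability_eq_sInf]
  refine csInf_le ⟨0, ?_⟩ ⟨M, hM, rfl⟩
  rintro _ ⟨M', hM', rfl⟩
  exact hM'.nonneg []

theorem le_upperProbability {φ : ForecastingSystem} {G : Set Path} {c : ℝ}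
    (h : ∀ M, IsSuperhedge φ G M → c ≤ M []) : c ≤ upperProbability φ G := by
  rw [upperProbability_eq_sInf]
  -- The constant `1` is a superhedge, so the infimum is over a non-empty set and is not the default
  -- value of `sInf`.
  refine le_csInf ⟨1, fun _ => 1, ⟨isSupermartingale_const φ 1, fun ω => ?_⟩, rfl⟩ ?_
  · rw [liminf_const]
    exact_mod_cast Set.indicator_le_self' (fun _ _ => zero_le_one) ω
  · rintro _ ⟨M, hM, rfl⟩
    exact h M hM

/-! ### Test randomness implies randomness -/

/-- The process `T`, frozen at the value `c` as soon as it has exceeded `c`. -/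
noncomputable def freeze (T : Situation → ℝ) (c : ℝ) (s : Situation) : ℝ :=
  open Classical in if ∃ t, t <+: s ∧ c < T t then c else T s

/-- At the moment of freezing the value only drops, from above `c` to `c`; afterwards the process is
constant. -/
theorem IsSupermartingale.freeze {φ : ForecastingSystem} {T : Situation → ℝ}
    (hT : IsSupermartingale φ T) (c : ℝ) : IsSupermartingale φ (freeze T c) := by
  rw [isSupermartingale_iff] at hT ⊢
  intro s p hp
  have hp0 : 0 ≤ p := (lowerForecast_nonneg φ s).trans hp.1
  have hp1 : p ≤ 1 := hp.2.trans (upperForecast_le_one φ s)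
  by_cases h : ∃ t, t <+: s ∧ c < T t
  · have hx : ∀ x, ∃ t, t <+: s ++ [x] ∧ c < T t := fun x =>
      h.imp fun t ht => ⟨ht.1.trans (List.prefix_append _ _), ht.2⟩
    simp only [GameRandomness.freeze, if_pos h, if_pos (hx _)]
    linarith
  · have hx : ∀ x, GameRandomness.freeze T c (s ++ [x]) ≤ T (s ++ [x]) := by
      intro x
      unfold GameRandomness.freeze
      split_ifs with h'
      · obtain ⟨t, ht, hc⟩ := h'
        rcases List.prefix_concat_iff.1 ht with rfl | ht
        · exact hc.le
        · exact absurd ⟨t, ht, hc⟩ h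
      · exact le_rfl
    have hs : GameRandomness.freeze T c s = T s := if_neg h
    rw [hs]
    refine le_trans ?_ (hT s p hp)
    have h1p : 0 ≤ 1 - p := by linarith
    gcongr <;> exact hx _

/-- Ville's inequality: the frozen process divided by `c` is a superhedge. Since `c ≥ 1`, it is not
yet frozen at the root, where it is worth `c⁻¹`. -/
theorem upperProbability_exceeds_le {φ : ForecastingSystem} {T : Situation → ℝ}
    (hT : IsTestSupermartingale φ T) {c : ℝ} (hc : 1 ≤ c) :
    upperProbability φ (cylinderSet {s | c < T s}) ≤ c⁻¹ := by
  obtain ⟨hsup, hnn, h1⟩ := hT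
  have hc0 : 0 < c := by linarith
  have hM : IsSuperhedge φ (cylinderSet {s | c < T s}) fun s => c⁻¹ * freeze T c s := by
    refine ⟨(hsup.freeze c).const_mul (by positivity), fun ω => ?_⟩
    refine le_liminf_of_le (by isBoundedDefault) ?_
    by_cases hω : ω ∈ cylinderSet {s | c < T s}
    · rw [Set.indicator_of_mem hω]
      obtain ⟨k, hk⟩ := mem_cylinderSet.1 hω
      filter_upwards [eventually_ge_atTop k] with n hn
      rw [freeze, if_pos ⟨_, Path.upTo_prefix_upTo ω hn, hk⟩, inv_mul_cancel₀ hc0.ne']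
    · rw [Set.indicator_of_notMem hω]
      refine Eventually.of_forall fun n => ?_
      have : 0 ≤ c⁻¹ * freeze T c (Path.upTo ω n) := by
        refine mul_nonneg (by positivity) ?_
        unfold freeze
        split_ifs
        · exact hc0.le
        · exact hnn _
      exact_mod_cast this
  refine (upperProbability_le hM).trans (le_of_eq ?_)
  have : ¬∃ t, t <+: ([] : Situation) ∧ c < T t := by
    rintro ⟨t, ht, h⟩
    rw [List.prefix_nil.1 ht, h1] at h
    linarith
  simp only [freeze, if_neg this, h1, mul_one]

theorem rePred_two_pow_lt {T : Situation → ℝ} (hT : LowerSemicomputable T) :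
    REPred fun a : ℕ × Situation => (2 : ℝ) ^ a.1 < T a.2 := by
  obtain ⟨q, ⟨a, b, c, ha, hb, hc, hq⟩, hmono, hlim⟩ := hT
  have hcomp : Computable fun x : (ℕ × Situation) × ℕ =>
      decide (b (x.1.2, x.2) + 2 ^ x.1.1 * (c (x.1.2, x.2) + 1) < a (x.1.2, x.2)) := by
    have hy : Computable fun x : (ℕ × Situation) × ℕ => (x.1.2, x.2) :=
      (Computable.snd.comp Computable.fst).pair Computable.snd
    exact Primrec.nat_lt.decide.to_comp.comp
      (Primrec.nat_add.to_comp.comp (hb.comp hy) (Primrec.nat_mul.to_comp.comp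
        (computable_two_pow (Computable.fst.comp Computable.fst))
        (Computable.succ.comp (hc.comp hy)))) (ha.comp hy)
  refine (rePred_of_exists hcomp).of_eq ?_
  rintro ⟨n, s⟩
  have hiff : ∀ k, b (s, k) + 2 ^ n * (c (s, k) + 1) < a (s, k) ↔ (2 : ℝ) ^ n < q (s, k) := by
    intro k
    have hcpos : (0 : ℝ) < (c (s, k) : ℝ) + 1 := by positivity
    rw [hq]
    push_cast
    rw [lt_div_iff₀ hcpos, lt_sub_iff_add_lt, add_comm]
    exact_mod_cast Iff.rfl
  simp only [decide_eq_true_eq, hiff]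
  constructor
  · rintro ⟨k, hk⟩
    refine hk.trans_le (Monotone.ge_of_tendsto (f := fun n => (q (s, n) : ℝ))
      (monotone_nat_of_le_succ fun n => by exact_mod_cast hmono s n) (hlim s) k)
  · intro h
    exact ((hlim s).eventually_const_lt h).exists

theorem MartinLofTestRandom.martinLofRandom {φ : ForecastingSystem} {ω : Path}
    (h : MartinLofTestRandom φ ω) : MartinLofRandom φ ω := by
  intro T hT hlsc
  by_contra! hunb
  refine h (fun n => cylinderSet {s | (2 : ℝ) ^ n < T s})
    ⟨{a | (2 : ℝ) ^ a.1 < T a.2}, rePred_two_pow_lt hlsc, fun n => ⟨rfl, ?_⟩⟩ ?_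
  · refine (upperProbability_exceeds_le hT (c := 2 ^ n) (one_le_pow₀ (by norm_num))).trans ?_
    simp
  · exact Set.mem_iInter.2 fun n => mem_cylinderSet.2 (hunb (2 ^ n))

/-! ### One backward step -/

/-- For `h + k ≥ 1`, the maximum of `(1 - p) a + p b` over `p ∈ [1 - k, h]`. -/
def mix (h k a b : ℝ) : ℝ := min a b + h * max (b - a) 0 + k * max (a - b) 0

theorem mix_of_le {a b : ℝ} (h k : ℝ) (hab : a ≤ b) : mix h k a b = (1 - h) * a + h * b := by
  rw [mix, min_eq_left hab, max_eq_left (by linarith), max_eq_right (by linarith)]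
  ring

theorem mix_of_ge {a b : ℝ} (h k : ℝ) (hab : b ≤ a) : mix h k a b = k * a + (1 - k) * b := by
  rw [mix, min_eq_right hab, max_eq_right (by linarith), max_eq_left (by linarith)]
  ring

/-- The form of `mix` as a minimum plus weighted positive parts keeps it monotone even when `h + k <
1`, which can happen for lower approximations of the forecasts. -/
theorem mix_le_mix {h k a b h' k' a' b' : ℝ} (h0 : 0 ≤ h) (k0 : 0 ≤ k) (hh : h ≤ h')
    (hk : k ≤ k') (h1 : h' ≤ 1) (k1 : k' ≤ 1) (ha : a ≤ a') (hb : b ≤ b') :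
    mix h k a b ≤ mix h' k' a' b' := by
  rcases le_total a b with hab | hab <;> rcases le_total a' b' with hab' | hab' <;>
    simp only [mix_of_le, mix_of_ge, hab, hab'] <;> nlinarith

theorem convex_le_mix {p h k a b : ℝ} (hp : p ≤ h) (kp : 1 - p ≤ k) :
    p * b + (1 - p) * a ≤ mix h k a b := by
  rcases le_total a b with hab | hab <;> simp only [mix_of_le, mix_of_ge, hab] <;> nlinarith

/-- The expectation is affine in `p`, so the supermartingale inequality is used at the endpoint
favouring the larger child. -/
theorem mix_le_of_isSupermartingale {φ : ForecastingSystem} {M : Situation → ℝ}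
    (hM : IsSupermartingale φ M) {s : Situation} {h k a b : ℝ} (h0 : 0 ≤ h) (k0 : 0 ≤ k)
    (hh : h ≤ upperForecast φ s) (hk : k ≤ 1 - lowerForecast φ s)
    (ha : a ≤ M (s ++ [false])) (hb : b ≤ M (s ++ [true])) : mix h k a b ≤ M s := by
  have hlu := lowerForecast_le_upperForecast φ s
  refine (mix_le_mix h0 k0 hh hk (upperForecast_le_one φ s)
    (by linarith [lowerForecast_nonneg φ s]) ha hb).trans ?_
  rw [isSupermartingale_iff] at hM
  rcases le_total (M (s ++ [false])) (M (s ++ [true])) with hab | hab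
  · rw [mix_of_le _ _ hab]
    linarith [hM s _ ⟨hlu, le_rfl⟩]
  · rw [mix_of_ge _ _ hab]
    linarith [hM s _ ⟨le_rfl, hlu⟩]

/-- `mix` on numerators over the common denominator `D`, rounded down. -/
def mixNat (D H K a b : ℕ) : ℕ := min a b + (H * (b - a) + K * (a - b)) / D

theorem mixNat_eq_floor {D : ℕ} (hD : 0 < D) (H K a b : ℕ) :
    mixNat D H K a b = ⌊(D : ℝ) * mix (H / D) (K / D) (a / D) (b / D)⌋₊ := by
  have hD' : (0 : ℝ) < D := by exact_mod_cast hD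
  have key : (D : ℝ) * mix (H / D) (K / D) (a / D) (b / D) =
      ((min a b : ℕ) : ℝ) + ((H * (b - a) + K * (a - b) : ℕ) : ℝ) / (D : ℝ) := by
    rcases le_total a b with hab | hab
    · have hab' : (a : ℝ) / D ≤ b / D := by gcongr
      rw [mix_of_le _ _ hab', min_eq_left hab, Nat.sub_eq_zero_of_le hab]
      push_cast [Nat.cast_sub hab]
      field_simp
      ring
    · have hab' : (b : ℝ) / D ≤ a / D := by gcongr
      rw [mix_of_ge _ _ hab', min_eq_right hab, Nat.sub_eq_zero_of_le hab]
      push_cast [Nat.cast_sub hab]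
      field_simp
      ring
  rw [key, add_comm, Nat.floor_add_natCast (by positivity), Nat.floor_div_eq_div, add_comm]
  rfl

theorem mix_nonneg {h k a b : ℝ} (h0 : 0 ≤ h) (k0 : 0 ≤ k) (ha : 0 ≤ a) (hb : 0 ≤ b) :
    0 ≤ mix h k a b := by
  unfold mix
  positivity

/-! ### Approximate conditional upper probabilities -/

/-- Numerators, over the denominator `2 ^ m`, of lower approximations of the conditional upper
probability of hitting `{s | B (s, m)}`, computed by backward recursion over `k` steps. -/
def hedgeApprox (H K : Situation × ℕ → ℕ) (B : Situation × ℕ → Bool) (m : ℕ) :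
    ℕ → Situation → ℕ
  | 0, s => if B (s, m) then 2 ^ m else 0
  | k + 1, s => if B (s, m) then 2 ^ m else
      mixNat (2 ^ m) (H (s, m)) (K (s, m)) (hedgeApprox H K B m k (s ++ [false]))
        (hedgeApprox H K B m k (s ++ [true]))

/-- The approximations `hedgeApprox` that look at situations of length at most `m`. -/
def hedgeNum (H K : Situation × ℕ → ℕ) (B : Situation × ℕ → Bool) (s : Situation) (m : ℕ) : ℕ :=
  hedgeApprox H K B m (m - s.length) s

/-- The limit of the approximations `hedgeNum`. -/
noncomputable def hedge (H K : Situation × ℕ → ℕ) (B : Situation × ℕ → Bool)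
    (s : Situation) : ℝ :=
  ⨆ m, (hedgeNum H K B s m : ℝ) / 2 ^ m

/-- `H / 2 ^ m` and `K / 2 ^ m` increase to the upper forecast and to one minus the lower
forecast. -/
structure IsDyadicForecast (φ : ForecastingSystem) (H K : Situation × ℕ → ℕ) : Prop where
  upper_mono : ∀ s m, 2 * H (s, m) ≤ H (s, m + 1)
  upper_le : ∀ s m, (H (s, m) : ℝ) / 2 ^ m ≤ upperForecast φ s
  upper_tendsto : ∀ s, Tendsto (fun m => (H (s, m) : ℝ) / 2 ^ m) atTop (𝓝 (upperForecast φ s))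
  lower_mono : ∀ s m, 2 * K (s, m) ≤ K (s, m + 1)
  lower_le : ∀ s m, (K (s, m) : ℝ) / 2 ^ m ≤ 1 - lowerForecast φ s
  lower_tendsto :
    ∀ s, Tendsto (fun m => (K (s, m) : ℝ) / 2 ^ m) atTop (𝓝 (1 - lowerForecast φ s))

theorem ComputableForecast.exists_isDyadicForecast {φ : ForecastingSystem}
    (h : ComputableForecast φ) :
    ∃ H K : Situation × ℕ → ℕ, Computable H ∧ Computable K ∧ IsDyadicForecast φ H K := by
  obtain ⟨H, hH, H1, H2, H3⟩ := exists_dyadic_of_lowerSemicomputable 0 h.2.1 fun s => by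
    have := (lowerForecast_nonneg φ s).trans (lowerForecast_le_upperForecast φ s)
    simpa using this
  obtain ⟨K, hK, K1, K2, K3⟩ := exists_dyadic_of_lowerSemicomputable 1 h.1.2 fun s => by
    have := (lowerForecast_le_upperForecast φ s).trans (upperForecast_le_one φ s)
    simpa using this
  refine ⟨H, K, hH, hK, ⟨H1, ?_, ?_, K1, ?_, ?_⟩⟩
  · simpa using H2
  · simpa using H3
  · simpa [sub_eq_add_neg] using K2
  · simpa [sub_eq_add_neg] using K3

/-! ### Bounds, monotonicity and the supermartingale property of the backward recursion. -/

section hedge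

variable {φ : ForecastingSystem} {H K : Situation × ℕ → ℕ} {B : Situation × ℕ → Bool}

theorem hedgeApprox_of_hit {s : Situation} {m : ℕ} (h : B (s, m) = true) (k : ℕ) :
    hedgeApprox H K B m k s = 2 ^ m := by
  cases k <;> simp [hedgeApprox, h]

theorem hedgeApprox_succ {s : Situation} {m : ℕ} (h : ¬B (s, m) = true) (k : ℕ) :
    hedgeApprox H K B m (k + 1) s =
      mixNat (2 ^ m) (H (s, m)) (K (s, m)) (hedgeApprox H K B m k (s ++ [false]))
        (hedgeApprox H K B m k (s ++ [true])) := by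
  simp [hedgeApprox, h]

/-- Backward induction: too-small forecasts and rounding down can only decrease the value. With `M =
1` this bounds the fractions by `1`; with superhedges it yields the comparison with upper
probability. -/
theorem hedgeApprox_le (hφ : IsDyadicForecast φ H K) {M : Situation → ℝ}
    (hM : IsSupermartingale φ M) (hM0 : ∀ s, 0 ≤ M s) {m : ℕ}
    (hM1 : ∀ s, B (s, m) = true → 1 ≤ M s) (k : ℕ) (s : Situation) :
    (hedgeApprox H K B m k s : ℝ) / 2 ^ m ≤ M s := by
  induction k generalizing s with
  | zero =>
    unfold hedgeApprox
    split_ifs with h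
    · simpa using hM1 s h
    · simpa using hM0 s
  | succ k ih =>
    by_cases h : B (s, m) = true
    · rw [hedgeApprox_of_hit h]
      simpa using hM1 s h
    · rw [hedgeApprox_succ h, mixNat_eq_floor (by positivity), div_le_iff₀ (by positivity)]
      push_cast
      refine (Nat.floor_le ?_).trans ?_
      · exact mul_nonneg (by positivity)
          (mix_nonneg (by positivity) (by positivity) (by positivity) (by positivity))
      · rw [mul_comm]
        gcongr
        exact mix_le_of_isSupermartingale hM (by positivity) (by positivity)
          (hφ.upper_le s m) (hφ.lower_le s m) (ih _) (ih _)

/-- Passing from `m` to `m + 1` enlarges the hit set and both weights, and `k ≤ k'` enlarges the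
horizon; `mix` is monotone in all its arguments, and doubling a floor stays below the floor of the
double. -/
theorem two_mul_hedgeApprox_le (hφ : IsDyadicForecast φ H K)
    (hB : ∀ s m, B (s, m) = true → B (s, m + 1) = true) {m k k' : ℕ} (hk : k ≤ k')
    (s : Situation) : 2 * hedgeApprox H K B m k s ≤ hedgeApprox H K B (m + 1) k' s := by
  by_cases h' : B (s, m + 1) = true
  · rw [hedgeApprox_of_hit h', pow_succ, mul_comm]
    gcongr
    have := hedgeApprox_le (B := B) hφ (isSupermartingale_const φ 1) (fun _ => zero_le_one)
      (m := m) (fun _ _ => le_rfl) k s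
    rw [div_le_one (by positivity)] at this
    exact_mod_cast this
  · have h : ¬B (s, m) = true := fun h => h' (hB s m h)
    induction k generalizing k' s with
    | zero => simp [hedgeApprox, h]
    | succ k ih =>
      obtain ⟨j, rfl⟩ : ∃ j, k' = j + 1 := ⟨k' - 1, by omega⟩
      have hkj : k ≤ j := by omega
      have ih' : ∀ t, 2 * hedgeApprox H K B m k t ≤ hedgeApprox H K B (m + 1) j t := by
        intro t
        by_cases ht : B (t, m + 1) = true
        · rw [hedgeApprox_of_hit ht, pow_succ, mul_comm]
          gcongr
          have := hedgeApprox_le (B := B) hφ (isSupermartingale_const φ 1)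
            (fun _ => zero_le_one) (m := m) (fun _ _ => le_rfl) k t
          rw [div_le_one (by positivity)] at this
          exact_mod_cast this
        · exact ih hkj t ht fun h => ht (hB t m h)
      have hdiv : ∀ {x y : ℕ}, 2 * x ≤ y →
          (x : ℝ) / ((2 ^ m : ℕ) : ℝ) ≤ (y : ℝ) / ((2 ^ (m + 1) : ℕ) : ℝ) := by
        intro x y hxy
        have hxy' : (2 * x : ℝ) ≤ y := by exact_mod_cast hxy
        rw [div_le_div_iff₀ (by positivity) (by positivity)]
        push_cast
        rw [pow_succ]
        nlinarith [show (0 : ℝ) < 2 ^ m by positivity]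
      rw [hedgeApprox_succ h, hedgeApprox_succ h', mixNat_eq_floor (by positivity),
        mixNat_eq_floor (by positivity)]
      refine Nat.le_floor ?_
      rw [Nat.cast_mul]
      refine (mul_le_mul_of_nonneg_left (Nat.floor_le (mul_nonneg (by positivity)
        (mix_nonneg (by positivity) (by positivity) (by positivity) (by positivity))))
        (by positivity)).trans ?_
      rw [← mul_assoc, show ((2 : ℕ) : ℝ) * ((2 ^ m : ℕ) : ℝ) = ((2 ^ (m + 1) : ℕ) : ℝ) by
        push_cast; ring]
      gcongr
      have hu : (H (s, m + 1) : ℝ) / ((2 ^ (m + 1) : ℕ) : ℝ) ≤ 1 := by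
        have := (hφ.upper_le s (m + 1)).trans (upperForecast_le_one φ s)
        exact_mod_cast this
      have hl : (K (s, m + 1) : ℝ) / ((2 ^ (m + 1) : ℕ) : ℝ) ≤ 1 := by
        have := (hφ.lower_le s (m + 1)).trans (sub_le_self _ (lowerForecast_nonneg φ s))
        exact_mod_cast this
      exact mix_le_mix (by positivity) (by positivity) (hdiv (hφ.upper_mono s m))
        (hdiv (hφ.lower_mono s m)) hu hl (hdiv (ih' _)) (hdiv (ih' _))

theorem two_mul_hedgeNum_le (hφ : IsDyadicForecast φ H K)
    (hB : ∀ s m, B (s, m) = true → B (s, m + 1) = true) (s : Situation) (m : ℕ) :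
    2 * hedgeNum H K B s m ≤ hedgeNum H K B s (m + 1) :=
  two_mul_hedgeApprox_le hφ hB (by omega) s

theorem hedgeNum_div_le_one (hφ : IsDyadicForecast φ H K) (s : Situation) (m : ℕ) :
    (hedgeNum H K B s m : ℝ) / 2 ^ m ≤ 1 :=
  hedgeApprox_le hφ (isSupermartingale_const φ 1) (fun _ => zero_le_one) (fun _ _ => le_rfl) _ s

theorem bddAbove_hedgeNum (hφ : IsDyadicForecast φ H K) (s : Situation) :
    BddAbove (Set.range fun m => (hedgeNum H K B s m : ℝ) / 2 ^ m) :=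
  ⟨1, Set.forall_mem_range.2 (hedgeNum_div_le_one hφ s)⟩

theorem hedgeNum_div_le_hedge (hφ : IsDyadicForecast φ H K) (s : Situation) (m : ℕ) :
    (hedgeNum H K B s m : ℝ) / 2 ^ m ≤ hedge H K B s :=
  le_ciSup (bddAbove_hedgeNum hφ s) m

theorem hedge_nonneg (s : Situation) : 0 ≤ hedge H K B s :=
  Real.iSup_nonneg fun _ => by positivity

theorem hedge_le_one (hφ : IsDyadicForecast φ H K) (s : Situation) : hedge H K B s ≤ 1 :=
  ciSup_le (hedgeNum_div_le_one hφ s)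

theorem hedge_of_hit (hφ : IsDyadicForecast φ H K) {s : Situation} {m : ℕ}
    (h : B (s, m) = true) : hedge H K B s = 1 := by
  refine le_antisymm (hedge_le_one hφ s) ?_
  have := hedgeNum_div_le_hedge (B := B) hφ s m
  rw [hedgeNum, hedgeApprox_of_hit h] at this
  simpa using this

theorem tendsto_hedgeNum (hφ : IsDyadicForecast φ H K)
    (hB : ∀ s m, B (s, m) = true → B (s, m + 1) = true) (s : Situation) :
    Tendsto (fun m => (hedgeNum H K B s m : ℝ) / 2 ^ m) atTop (𝓝 (hedge H K B s)) := by
  refine tendsto_atTop_ciSup (monotone_nat_of_le_succ fun m => ?_) (bddAbove_hedgeNum hφ s)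
  have h : (2 * hedgeNum H K B s m : ℝ) ≤ hedgeNum H K B s (m + 1) := by
    exact_mod_cast two_mul_hedgeNum_le hφ hB s m
  rw [div_le_div_iff₀ (by positivity) (by positivity), pow_succ]
  nlinarith [show (0 : ℝ) < 2 ^ m by positivity]

theorem hedge_le (hφ : IsDyadicForecast φ H K) {M : Situation → ℝ}
    (hM : IsSupermartingale φ M) (hM0 : ∀ s, 0 ≤ M s)
    (hM1 : ∀ s m, B (s, m) = true → 1 ≤ M s) (s : Situation) : hedge H K B s ≤ M s :=
  ciSup_le fun m => hedgeApprox_le hφ hM hM0 (fun s => hM1 s m) _ s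

/-- At a hit the value is already the maximum `1`. Elsewhere the recursion at precision `m` is the
exact `mix` up to an error below `2⁻ᵐ`, and continuity of `mix` passes this to the limit. -/
theorem isSupermartingale_hedge (hφ : IsDyadicForecast φ H K)
    (hB : ∀ s m, B (s, m) = true → B (s, m + 1) = true) :
    IsSupermartingale φ (hedge H K B) := by
  rw [isSupermartingale_iff]
  intro s p hp
  by_cases hit : ∃ m, B (s, m) = true
  · obtain ⟨m, hm⟩ := hit
    rw [hedge_of_hit hφ hm]
    have h1 := hedge_le_one (B := B) hφ (s ++ [true])
    have h0 := hedge_le_one (B := B) hφ (s ++ [false])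
    have hp0 : 0 ≤ p := (lowerForecast_nonneg φ s).trans hp.1
    have hp1 : p ≤ 1 := hp.2.trans (upperForecast_le_one φ s)
    nlinarith
  · push Not at hit
    refine (convex_le_mix (h := upperForecast φ s) (k := 1 - lowerForecast φ s) hp.2
      (by linarith [hp.1])).trans ?_
    have hcont : Continuous fun x : ℝ × ℝ × ℝ × ℝ => mix x.1 x.2.1 x.2.2.1 x.2.2.2 := by
      unfold mix
      fun_prop
    have hmix := (hcont.tendsto _).comp ((hφ.upper_tendsto s).prodMk_nhds
      ((hφ.lower_tendsto s).prodMk_nhds ((tendsto_hedgeNum hφ hB (s ++ [false])).prodMk_nhds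
        (tendsto_hedgeNum hφ hB (s ++ [true])))))
    have hpow : Tendsto (fun m : ℕ => (1 / 2 : ℝ) ^ m) atTop (𝓝 0) :=
      tendsto_pow_atTop_nhds_zero_of_lt_one (by norm_num) (by norm_num)
    have hlim := hmix.sub hpow
    rw [sub_zero] at hlim
    -- For `m > s.length` the fuel at `s` is positive and one more than at its children, so one step
    -- of the recursion can be unfolded.
    refine le_of_tendsto hlim ?_
    filter_upwards [eventually_gt_atTop s.length] with m hm
    refine le_trans ?_ (hedgeNum_div_le_hedge hφ s m)
    have hfuel : ∀ x, m - (s ++ [x]).length = m - s.length - 1 := fun x => by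
      rw [List.length_append, List.length_singleton]
      omega
    have hnum : hedgeNum H K B s m = mixNat (2 ^ m) (H (s, m)) (K (s, m))
        (hedgeNum H K B (s ++ [false]) m) (hedgeNum H K B (s ++ [true]) m) := by
      rw [hedgeNum, hedgeNum, hedgeNum, hfuel, hfuel,
        show m - s.length = m - s.length - 1 + 1 by omega, hedgeApprox_succ (hit m)]
      simp
    rw [hnum, mixNat_eq_floor (by positivity), le_div_iff₀ (by positivity), sub_mul, ← mul_pow]
    have := Nat.lt_floor_add_one (((2 ^ m : ℕ) : ℝ) * mix ((H (s, m) : ℝ) / ((2 ^ m : ℕ) : ℝ))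
      ((K (s, m) : ℝ) / ((2 ^ m : ℕ) : ℝ))
      ((hedgeNum H K B (s ++ [false]) m : ℝ) / ((2 ^ m : ℕ) : ℝ))
      ((hedgeNum H K B (s ++ [true]) m : ℝ) / ((2 ^ m : ℕ) : ℝ)))
    norm_num at this ⊢
    linarith

end hedge

/-! ### Randomness implies test randomness -/

theorem computable_hedgeNum {H K : Situation × ℕ → ℕ} {B : (ℕ × Situation) × ℕ → Bool}
    (hH : Computable H) (hK : Computable K) (hB : Computable B) :
    Computable fun x : (ℕ × Situation) × ℕ =>
      hedgeNum H K (fun y => B ((x.1.1, y.1), y.2)) x.1.2 x.2 := by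
  have hBx : Computable fun x : (ℕ × ℕ) × Situation => B ((x.1.1, x.2), x.1.2) :=
    hB.comp (((Computable.fst.comp Computable.fst).pair Computable.snd).pair
      (Computable.snd.comp Computable.fst))
  have hpow : Computable fun x : (ℕ × ℕ) × Situation => 2 ^ x.1.2 :=
    computable_two_pow (Computable.snd.comp Computable.fst)
  have hsm : Computable fun x : (ℕ × ℕ) × Situation => (x.2, x.1.2) :=
    Computable.snd.pair (Computable.snd.comp Computable.fst)
  have hstep : Computable fun y : ((ℕ × ℕ) × Situation) × ℕ × ℕ =>
      mixNat (2 ^ y.1.1.2) (H (y.1.2, y.1.1.2)) (K (y.1.2, y.1.1.2)) y.2.1 y.2.2 := by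
    have ha : Computable fun y : ((ℕ × ℕ) × Situation) × ℕ × ℕ => y.2.1 :=
      Computable.fst.comp Computable.snd
    have hb : Computable fun y : ((ℕ × ℕ) × Situation) × ℕ × ℕ => y.2.2 :=
      Computable.snd.comp Computable.snd
    exact Primrec.nat_add.to_comp.comp (Primrec.nat_min.to_comp.comp ha hb)
      (Primrec.nat_div.to_comp.comp (Primrec.nat_add.to_comp.comp
        (Primrec.nat_mul.to_comp.comp (hH.comp (hsm.comp Computable.fst))
          (Primrec.nat_sub.to_comp.comp hb ha))
        (Primrec.nat_mul.to_comp.comp (hK.comp (hsm.comp Computable.fst))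
          (Primrec.nat_sub.to_comp.comp ha hb))) (hpow.comp Computable.fst))
  have hchild : ∀ x : Bool, Computable fun s : Situation => s ++ [x] := fun x =>
    Computable.list_concat.comp Computable.id (Computable.const x)
  have hbase : Computable fun x : (ℕ × ℕ) × Situation =>
      bif B ((x.1.1, x.2), x.1.2) then 2 ^ x.1.2 else 0 :=
    Computable.cond hBx hpow (Computable.const 0)
  have hcomb : Computable fun y : ((ℕ × ℕ) × Situation) × ℕ × ℕ =>
      bif B ((y.1.1.1, y.1.2), y.1.1.2) then 2 ^ y.1.1.2 else
        mixNat (2 ^ y.1.1.2) (H (y.1.2, y.1.1.2)) (K (y.1.2, y.1.1.2)) y.2.1 y.2.2 :=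
    Computable.cond (hBx.comp Computable.fst) (hpow.comp Computable.fst) hstep
  -- The test index and the precision stay fixed as parameters; only the situation moves in the
  -- recursion.
  have hrec := computable_treeRec (P := ℕ × ℕ) (D := Situation)
    (g := fun p k s => hedgeApprox H K (fun y => B ((p.1, y.1), y.2)) p.2 k s)
    hbase hcomb (hchild false) (hchild true)
    (fun p s => by simp [hedgeApprox, Bool.cond_eq_ite])
    (fun p k s => by simp [hedgeApprox, Bool.cond_eq_ite])
  have hs : Computable fun x : (ℕ × Situation) × ℕ => x.1.2 :=
    Computable.snd.comp Computable.fst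
  have harg : Computable fun x : (ℕ × Situation) × ℕ =>
      (((x.1.1, x.2), x.1.2), x.2 - x.1.2.length) :=
    (((Computable.fst.comp Computable.fst).pair Computable.snd).pair hs).pair
      (Primrec.nat_sub.to_comp.comp Computable.snd (Computable.list_length.comp hs))
  exact (hrec.comp harg).of_eq fun x => by simp only [hedgeNum]

/-- Searching over prefixes closes `A` under extension, so a hit persists along a path. A search
index pairs a prefix length with a stage, and searching all indices below `m` makes the test
monotone in `m`. -/
theorem exists_prefix_stage {A : Set (ℕ × Situation)} (hA : REPred fun a => a ∈ A) :
    ∃ B : (ℕ × Situation) × ℕ → Bool, Computable B ∧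
      (∀ x m, B (x, m) = true → B (x, m + 1) = true) ∧
      ∀ n s, (∃ m, B ((n, s), m) = true) ↔ ∃ t, t <+: s ∧ (n, t) ∈ A := by
  obtain ⟨d, hd, hdA⟩ := exists_decidable_stage hA
  have hd' : Computable fun x : (ℕ × Situation) × ℕ =>
      d ((x.1.1, x.1.2.take x.2.unpair.1), x.2.unpair.2) := by
    have hu : Computable fun x : (ℕ × Situation) × ℕ => x.2.unpair :=
      Computable.unpair.comp Computable.snd
    exact hd.comp (((Computable.fst.comp Computable.fst).pair
      (Primrec.list_take.to_comp.comp (Computable.fst.comp hu)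
        (Computable.snd.comp Computable.fst))).pair (Computable.snd.comp hu))
  obtain ⟨B, hB, hBd⟩ := computable_exists_lt hd'
  refine ⟨B, hB, fun x m h => ?_, fun n s => ?_⟩
  · obtain ⟨k, hk, h⟩ := (hBd x m).1 h
    exact (hBd x (m + 1)).2 ⟨k, by omega, h⟩
  · simp only [hBd]
    constructor
    · rintro ⟨_, k, _, h⟩
      exact ⟨_, List.take_prefix _ _, (hdA _).2 ⟨_, h⟩⟩
    · rintro ⟨t, ht, h⟩
      obtain ⟨j, hj⟩ := (hdA _).1 h
      refine ⟨Nat.pair t.length j + 1, Nat.pair t.length j, by omega, ?_⟩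
      simpa [← List.prefix_iff_eq_take.1 ht] using hj

/-- Under a non-degenerate forecasting system, summability of non-negative supermartingales at the
initial situation propagates to all situations. -/
theorem NonDegenerate.summable {φ : ForecastingSystem} (hφ : NonDegenerate φ)
    {E : ℕ → Situation → ℝ} (hE : ∀ n, IsSupermartingale φ (E n)) (hE0 : ∀ n s, 0 ≤ E n s)
    (h : Summable fun n => E n []) (s : Situation) : Summable fun n => E n s := by
  induction s using List.reverseRecOn with
  | nil => exact h
  | append_singleton s x ih =>
    obtain ⟨hl, hu⟩ := hφ s
    have hlu := lowerForecast_le_upperForecast φ s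
    have hE' := fun n => isSupermartingale_iff.1 (hE n) s
    cases x
    · have hl' : 0 < 1 - lowerForecast φ s := by linarith
      refine Summable.of_nonneg_of_le (fun n => hE0 n _) (fun n => ?_)
        (ih.div_const (1 - lowerForecast φ s))
      rw [le_div_iff₀ hl']
      have := hE' n _ ⟨le_rfl, hlu⟩
      have := mul_nonneg (lowerForecast_nonneg φ s) (hE0 n (s ++ [true]))
      linarith
    · refine Summable.of_nonneg_of_le (fun n => hE0 n _) (fun n => ?_)
        (ih.div_const (upperForecast φ s))
      rw [le_div_iff₀ hu]
      have := hE' n _ ⟨hlu, le_rfl⟩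
      have := mul_nonneg (sub_nonneg.2 (upperForecast_le_one φ s)) (hE0 n (s ++ [false]))
      linarith

theorem isSupermartingale_tsum {φ : ForecastingSystem} {E : ℕ → Situation → ℝ}
    (hE : ∀ n, IsSupermartingale φ (E n)) (hs : ∀ s, Summable fun n => E n s) :
    IsSupermartingale φ fun s => ∑' n, E n s := by
  rw [isSupermartingale_iff]
  intro s p hp
  rw [← tsum_mul_left, ← tsum_mul_left, ← ((hs _).mul_left _).tsum_add ((hs _).mul_left _)]
  exact (((hs _).mul_left _).add ((hs _).mul_left _)).tsum_le_tsum
    (fun n => isSupermartingale_iff.1 (hE n) s p hp) (hs s)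

/-- The root is nobody's child, so raising its value keeps the supermartingale inequality. -/
theorem isTestSupermartingale_update {φ : ForecastingSystem} {W : Situation → ℝ}
    (hW : IsSupermartingale φ W) (hW0 : ∀ s, 0 ≤ W s) (hW1 : W [] ≤ 1) :
    IsTestSupermartingale φ fun s => if s = [] then 1 else W s := by
  refine ⟨isSupermartingale_iff.2 fun s p hp => ?_, fun s => ?_, if_pos rfl⟩
  · have := isSupermartingale_iff.1 hW s p hp
    simp only [List.append_eq_nil_iff, List.cons_ne_self, and_false, if_false]
    split_ifs with h
    · subst h
      exact this.trans hW1
    · exact this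
  · dsimp only
    split_ifs
    · exact zero_le_one
    · exact hW0 s

theorem lowerSemicomputable_tsum_hedge {H K : Situation × ℕ → ℕ} {φ : ForecastingSystem}
    (hφ : IsDyadicForecast φ H K) (hH : Computable H) (hK : Computable K)
    {B : (ℕ × Situation) × ℕ → Bool} (hBc : Computable B)
    (hB : ∀ x m, B (x, m) = true → B (x, m + 1) = true)
    (hs : ∀ s, Summable fun n => hedge H K (fun y => B ((n + 1, y.1), y.2)) s) :
    LowerSemicomputable fun s : Situation =>
      if s = [] then 1 else ∑' n, hedge H K (fun y => B ((n + 1, y.1), y.2)) s := by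
  let Q : (Situation × ℕ) × ℕ → ℕ := fun x =>
    hedgeNum H K (fun y => B ((x.2 + 1, y.1), y.2)) x.1.1 x.1.2
  have hQ : Computable Q := (computable_hedgeNum hH hK hBc).comp
    (((Computable.succ.comp Computable.snd).pair (Computable.fst.comp Computable.fst)).pair
      (Computable.snd.comp Computable.fst))
  have hQmono : ∀ s m n, 2 * Q ((s, m), n) ≤ Q ((s, m + 1), n) := fun s m n =>
    two_mul_hedgeNum_le hφ (fun t k => hB (n + 1, t) k) s m
  refine lowerSemicomputable_of_dyadic (N := fun x => bif decide (x.1 = []) then 2 ^ x.2 else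
    ∑ n ∈ Finset.range x.2, Q (x, n)) ?_ ?_ ?_
  · exact Computable.cond ((Primrec.eq (α := Situation)).decide.to_comp.comp
      Computable.fst (Computable.const []))
      (computable_two_pow Computable.snd) (computable_sum_range hQ Computable.snd)
  · intro s m
    by_cases h : s = []
    · simp [h, pow_succ, mul_comm]
    · simp only [h, decide_false, cond_false]
      rw [Finset.mul_sum, Finset.sum_range_succ]
      exact (Finset.sum_le_sum fun n _ => hQmono s m n).trans (Nat.le_add_right _ _)
  · intro s
    by_cases h : s = []
    · simp [h]
    · simp only [h, decide_false, cond_false, if_false]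
      -- The `m`-th approximation sums the first `m` terms at precision `m`; the limits themselves
      -- are the summable bound.
      have hdom := tendsto_tsum_of_dominated_convergence (𝓕 := atTop)
        (f := fun m n => if n < m then (Q ((s, m), n) : ℝ) / 2 ^ m else 0) (hs s)
        (g := fun n => hedge H K (fun y => B ((n + 1, y.1), y.2)) s) ?_ ?_
      · refine hdom.congr fun m => ?_
        rw [tsum_eq_sum (s := Finset.range m)]
        · push_cast
          rw [Finset.sum_div]
          exact Finset.sum_congr rfl fun n hn => if_pos (Finset.mem_range.1 hn)
        · intro n hn
          exact if_neg (by simpa using hn)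
      · intro n
        refine (tendsto_hedgeNum hφ (fun t k => hB (n + 1, t) k) s).congr' ?_
        filter_upwards [eventually_gt_atTop n] with m hm
        rw [if_pos hm]
      · refine Eventually.of_forall fun m n => ?_
        rw [Real.norm_of_nonneg (by positivity)]
        split_ifs
        · exact hedgeNum_div_le_hedge hφ s m
        · exact hedge_nonneg s

theorem MartinLofRandom.martinLofTestRandom {φ : ForecastingSystem} {ω : Path}
    (hnd : NonDegenerate φ) (hc : ComputableForecast φ) (h : MartinLofRandom φ ω) :
    MartinLofTestRandom φ ω := by
  rintro G ⟨A, hA, hG⟩ hω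
  obtain ⟨H, K, hH, hK, hHK⟩ := hc.exists_isDyadicForecast
  obtain ⟨B, hBc, hB, hBA⟩ := exists_prefix_stage hA
  -- The shift to `n + 1` makes the initial values sum to at most `1`.
  let E : ℕ → Situation → ℝ := fun n => hedge H K fun y => B ((n + 1, y.1), y.2)
  have hEs : ∀ n, IsSupermartingale φ (E n) := fun n =>
    isSupermartingale_hedge hHK fun s m => hB (n + 1, s) m
  have hE0 : ∀ n s, 0 ≤ E n s := fun n s => hedge_nonneg s
  have hgeom : HasSum (fun n : ℕ => (1 / 2 : ℝ) ^ (n + 1)) 1 := by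
    have := hasSum_geometric_two.mul_left (1 / 2 : ℝ)
    simpa [pow_succ, mul_comm] using this
  have hEnil : ∀ n, E n [] ≤ (1 / 2 : ℝ) ^ (n + 1) := fun n => by
    refine (le_upperProbability fun M hM => ?_).trans (hG (n + 1)).2
    refine hedge_le hHK hM.1 hM.nonneg (fun s m hit => hM.one_le fun ω' hω' => ?_) []
    obtain ⟨t, ht, htA⟩ := (hBA (n + 1) s).1 ⟨m, hit⟩
    obtain ⟨k, hk⟩ := mem_cylinder_of_prefix hω' ht
    exact mem_cylinderSet.2 ⟨k, by rw [hk]; exact htA⟩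
  have hsum0 : Summable fun n => E n [] :=
    Summable.of_nonneg_of_le (fun n => hE0 n _) hEnil hgeom.summable
  have hsum := hnd.summable hEs hE0 hsum0
  have hT := isTestSupermartingale_update (isSupermartingale_tsum hEs hsum)
    (fun s => tsum_nonneg fun n => hE0 n s)
    ((hsum0.tsum_le_tsum hEnil hgeom.summable).trans hgeom.tsum_eq.le)
  obtain ⟨b, hb⟩ := h _ hT (lowerSemicomputable_tsum_hedge hHK hH hK hBc hB hsum)
  obtain ⟨N, hN⟩ := exists_nat_gt b
  have hhit : ∀ n, ∃ k, ∀ j, k ≤ j → E n (Path.upTo ω j) = 1 := fun n => by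
    have hn := Set.mem_iInter.1 hω (n + 1)
    rw [(hG (n + 1)).1] at hn
    obtain ⟨k, hk⟩ := mem_cylinderSet.1 hn
    refine ⟨k, fun j hj => ?_⟩
    obtain ⟨m, hm⟩ := (hBA (n + 1) (Path.upTo ω j)).2 ⟨_, Path.upTo_prefix_upTo ω hj, hk⟩
    exact hedge_of_hit hHK hm
  choose k hk using hhit
  -- By time `j` the first `N` summands all equal `1`; the extra step avoids the root, where the sum
  -- was replaced by `1`.
  let j := (Finset.range N).sup k + 1
  have hj : ∀ n ∈ Finset.range N, E n (Path.upTo ω j) = 1 := fun n hn =>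
    hk n j ((Finset.le_sup hn).trans (Nat.le_succ _))
  have hne : Path.upTo ω j ≠ [] := by
    rw [← List.length_pos_iff_ne_nil, Path.length_upTo]
    exact Nat.succ_pos _
  have hle := hb j
  rw [if_neg hne] at hle
  have hpart := (hsum (Path.upTo ω j)).sum_le_tsum (Finset.range N) fun n _ => hE0 n _
  rw [Finset.sum_congr rfl hj] at hpart
  simp only [Finset.sum_const, Finset.card_range, nsmul_eq_mul, mul_one] at hpart
  linarith

end GameRandomness

theorem mainTheorem1 (φ : GameRandomness.ForecastingSystem) (ω : GameRandomness.Path) :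
    (GameRandomness.MartinLofTestRandom φ ω → GameRandomness.MartinLofRandom φ ω) ∧
    (GameRandomness.NonDegenerate φ → GameRandomness.ComputableForecast φ →
      (GameRandomness.MartinLofRandom φ ω ↔ GameRandomness.MartinLofTestRandom φ ω)) :=
  ⟨fun h => h.martinLofRandom, fun hnd hc =>
    ⟨fun h => h.martinLofTestRandom hnd hc, fun h => h.martinLofRandom⟩⟩
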